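/- A numerical semigroup is a submonoid $S$ of $(\mathbb{N},+)$ (where $0\in\mathbb{N}$) with finite complement in $\mathbb{N}$. Let $f(S)$ be its Frobenius number, that is, the largest integer not belonging to $S$ (so $f(\mathbb{N})=-1$); let $m(S)=\min\{s\in S : s>0\}$ be its multiplicity; let $\nu(S)$ be its embedding dimension, that is, the number of elements of its unique minimal system of generators (the minimal elements of $S\setminus\{0\}$ for the order $s\preceq t \iff t-s\in S$); and let $n(S)=|\{s\in S : s<f(S)\}|$. The semigroup $S$ is said to satisfy Wilf's conjecture if $f(S)+1\le n(S)\,\nu(S)$. Every numerical semigroup $S$ with $m(S)\le 8$ satisfies Wilf's conjecture, i.e. $f(S)+1\le n(S)\,\nu(S)$. -/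

import Mathlib

namespace NumSgp

/-- A numerical semigroup: a submonoid of `(ℕ, +)` with finite complement in `ℕ`. -/
def IsNumericalSemigroup (S : AddSubmonoid ℕ) : Prop :=
  ((S : Set ℕ)ᶜ).Finite

/-- The integers that do not belong to `S` (all negative integers and the gaps of `S`). -/
def integerGaps (S : AddSubmonoid ℕ) : Set ℤ :=
  {x : ℤ | ¬ ∃ s ∈ S, (s : ℤ) = x}

/-- The Frobenius number `f(S)`: the largest integer not belonging to `S`.
It is an integer, and equals `-1` when `S = ℕ`. -/
noncomputable def frobenius (S : AddSubmonoid ℕ) : ℤ :=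
  sSup (integerGaps S)

/-- The multiplicity `m(S)`: the smallest positive element of `S`. -/
noncomputable def multiplicity (S : AddSubmonoid ℕ) : ℕ :=
  sInf {s : ℕ | s ∈ S ∧ 0 < s}

/-- The partial order `s ≼ t` induced by `S`: there is `u ∈ S` with `s + u = t`. -/
def Preceq (S : AddSubmonoid ℕ) (s t : ℕ) : Prop :=
  ∃ u ∈ S, s + u = t

/-- The minimal system of generators of `S`: the minimal elements of `S \ {0}` with respect to
`≼`. By `minimal_closure_eq_iff` below it is the unique minimal generating set of `S`. -/
def minimalGenerators (S : AddSubmonoid ℕ) : Set ℕ :=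
  {g : ℕ | g ∈ S ∧ g ≠ 0 ∧ ∀ s ∈ S, s ≠ 0 → Preceq S s g → s = g}

/-- The embedding dimension `ν(S)`: the number of minimal generators of `S`
(finitely many, by `finite_minimalGenerators` below). -/
noncomputable def embeddingDim (S : AddSubmonoid ℕ) : ℕ :=
  (minimalGenerators S).ncard

/-- `n(S)`: the number of elements of `S` smaller than the Frobenius number. -/
noncomputable def smallCount (S : AddSubmonoid ℕ) : ℕ :=
  {s : ℕ | s ∈ S ∧ (s : ℤ) < frobenius S}.ncard

/-- `S` satisfies Wilf's conjecture: `f(S) + 1 ≤ n(S) ν(S)`. -/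
def SatisfiesWilf (S : AddSubmonoid ℕ) : Prop :=
  frobenius S + 1 ≤ (smallCount S : ℤ) * (embeddingDim S : ℤ)

/-- The Frobenius number of a numerical semigroup is the largest integer outside it. -/
theorem isGreatest_frobenius {S : AddSubmonoid ℕ} (hS : IsNumericalSemigroup S) :
    IsGreatest (integerGaps S) (frobenius S) := by
  have hne : (integerGaps S).Nonempty := by
    refine ⟨-1, ?_⟩
    rintro ⟨s, -, hs⟩
    omega
  have hbd : BddAbove (integerGaps S) := by
    obtain ⟨b, hb⟩ := hS.bddAbove
    refine ⟨(b : ℤ), fun x hx => ?_⟩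
    by_contra hlt
    push Not at hlt
    lift x to ℕ using by omega
    have hxS : x ∈ (S : Set ℕ)ᶜ := fun h => hx ⟨x, h, rfl⟩
    have := hb hxS
    omega
  exact ⟨Int.csSup_mem hne hbd, fun x hx => le_csSup hbd hx⟩

/-- The multiplicity of a numerical semigroup is its least positive element. -/
theorem isLeast_multiplicity {S : AddSubmonoid ℕ} (hS : IsNumericalSemigroup S) :
    IsLeast {s : ℕ | s ∈ S ∧ 0 < s} (multiplicity S) := by
  have hne : {s : ℕ | s ∈ S ∧ 0 < s}.Nonempty := by
    obtain ⟨b, hb⟩ := hS.bddAbove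
    refine ⟨b + 1, ?_, Nat.succ_pos b⟩
    by_contra h
    have := hb (show b + 1 ∈ (S : Set ℕ)ᶜ from h)
    omega
  exact ⟨Nat.sInf_mem hne, fun x hx => Nat.sInf_le hx⟩

theorem minimalGenerators_subset_of_closure_eq {S : AddSubmonoid ℕ} {G : Set ℕ}
    (hG : AddSubmonoid.closure G = S) : minimalGenerators S ⊆ G := by
  subst hG
  rintro g ⟨hg, hg0, hmin⟩
  have key : ∀ x ∈ AddSubmonoid.closure G, x = 0 ∨
      ∃ a ∈ G, a ≠ 0 ∧ Preceq (AddSubmonoid.closure G) a x := by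
    intro x hx
    induction hx using AddSubmonoid.closure_induction with
    | mem x hx =>
      by_cases h : x = 0
      · exact Or.inl h
      · exact Or.inr ⟨x, hx, h, 0, zero_mem _, add_zero x⟩
    | zero => exact Or.inl rfl
    | add x y hx hy ihx ihy =>
      rcases ihx with rfl | ⟨a, ha, ha0, u, hu, rfl⟩
      · simpa using ihy
      · exact Or.inr ⟨a, ha, ha0, u + y, add_mem hu hy, by omega⟩
  rcases key g hg with h | ⟨a, ha, ha0, hle⟩
  · exact absurd h hg0
  · exact hmin a (AddSubmonoid.subset_closure ha) ha0 hle ▸ ha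

theorem closure_minimalGenerators (S : AddSubmonoid ℕ) :
    AddSubmonoid.closure (minimalGenerators S) = S := by
  apply le_antisymm
  · exact AddSubmonoid.closure_le.2 fun g hg => hg.1
  · intro x
    induction x using Nat.strong_induction_on with
    | _ x ih =>
      intro hx
      by_cases h0 : x = 0
      · subst h0
        exact zero_mem _
      by_cases hm : x ∈ minimalGenerators S
      · exact AddSubmonoid.subset_closure hm
      have : ∃ s ∈ S, s ≠ 0 ∧ Preceq S s x ∧ s ≠ x := by
        by_contra hcon
        push Not at hcon
        exact hm ⟨hx, h0, hcon⟩
      obtain ⟨s, hs, hs0, ⟨u, hu, rfl⟩, hne⟩ := this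
      exact add_mem (ih s (by omega) hs) (ih u (by omega) hu)

/-- `minimalGenerators S` is the unique minimal system of generators of `S`. -/
theorem minimal_closure_eq_iff (S : AddSubmonoid ℕ) (G : Set ℕ) :
    Minimal (fun T : Set ℕ => AddSubmonoid.closure T = S) G ↔ G = minimalGenerators S := by
  constructor
  · intro h
    have hsub := minimalGenerators_subset_of_closure_eq h.prop
    exact Set.Subset.antisymm (h.le_of_le (closure_minimalGenerators S) hsub) hsub
  · rintro rfl
    exact ⟨closure_minimalGenerators S,
      fun T hT _ => minimalGenerators_subset_of_closure_eq hT⟩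

/-- A numerical semigroup has only finitely many minimal generators. -/
theorem finite_minimalGenerators {S : AddSubmonoid ℕ} (hS : IsNumericalSemigroup S) :
    (minimalGenerators S).Finite := by
  obtain ⟨⟨hm, hm0⟩, -⟩ := isLeast_multiplicity hS
  obtain ⟨b, hb⟩ := hS.bddAbove
  refine (Set.finite_Iic (b + multiplicity S)).subset fun g hg => ?_
  by_contra hlt
  simp only [Set.mem_Iic, not_le] at hlt
  have hu : g - multiplicity S ∈ S := by
    by_contra h
    have := hb (show g - multiplicity S ∈ (S : Set ℕ)ᶜ from h)
    omega
  have := hg.2.2 _ hm hm0.ne' ⟨_, hu, by omega⟩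
  omega

end NumSgp

namespace NumSgp

/-! Let `c = f(S) + 1` and let `n`, `ν`, `m` be as in the statement. The proof splits on `ν`.

If `ν ≤ 3`, every gap is `g - s` with `g` pseudo-Frobenius and `s ∈ S` below `c`, so `c ≤ n * (t +
1)` for `t` the number of natural pseudo-Frobenius numbers (`conductor_le_mul`). With at most three
generators `t + 1 ≤ ν` (`ncard_pseudoFrobenius_lt`); the case `ν = 3` is a staircase argument in the
plane.

If `ν ≥ 4`, then `m ≤ 8` leaves at most four decomposable nonzero Apéry elements (the set `D`). Put
`q = ⌈c / m⌉`, so that `c ≤ q * m = q * ν + q * |D|`. The multiples of `m` contribute `q` to `n`,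
and the Apéry elements occurring as summands in `D` contribute some `T`, so `q * |D| ≤ 4 * T`
suffices. A decomposition `u + w ∈ D` forces the classes of `u` and `w` to contribute at least `q -
1` together, because `u + w < c + m` (`conductor_le_of_four_le`). -/

theorem exists_conductor {S : AddSubmonoid ℕ} (hS : IsNumericalSemigroup S) :
    ∃ c : ℕ, frobenius S + 1 = c ∧ (∀ x, c ≤ x → x ∈ S) ∧
      smallCount S = {s : ℕ | s ∈ S ∧ s < c}.ncard := by
  obtain ⟨hf, hmax⟩ := isGreatest_frobenius hS
  have hneg : -1 ≤ frobenius S := hmax (by rintro ⟨s, -, hs⟩; omega)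
  obtain ⟨c, hc⟩ := Int.eq_ofNat_of_zero_le (show 0 ≤ frobenius S + 1 by omega)
  refine ⟨c, hc, fun x hx => ?_, ?_⟩
  · by_contra hxS
    have : (x : ℤ) ≤ frobenius S := hmax (by
      rintro ⟨s, hs, hsx⟩
      exact hxS (by rwa [← Nat.cast_inj.1 hsx]))
    omega
  · unfold smallCount
    congr 1
    ext s
    simp only [Set.mem_ofPred_eq]
    refine and_congr_right fun hs => ⟨fun h => by omega, fun h => ?_⟩
    have : (s : ℤ) ≠ frobenius S := fun h => hf ⟨s, hs, h⟩
    omega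

/-! ### Pseudo-Frobenius numbers and the count of gaps -/

/-- The pseudo-Frobenius numbers of `S` that are natural numbers. -/
def pseudoFrobenius (S : AddSubmonoid ℕ) : Set ℕ :=
  {g | g ∉ S ∧ ∀ s ∈ S, s ≠ 0 → g + s ∈ S}

/-- A gap that is not pseudo-Frobenius stays a gap after adding some nonzero element of `S`; the
climb stops before `c`, and `k` bounds the number of steps left. -/
theorem exists_pseudoFrobenius {S : AddSubmonoid ℕ} {c : ℕ} (hc : ∀ x, c ≤ x → x ∈ S) :
    ∀ (k x : ℕ), c ≤ x + k → x ∉ S → ∃ g ∈ pseudoFrobenius S, ∃ s ∈ S, x + s = g := by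
  intro k
  induction k with
  | zero => exact fun x hx hxS => absurd (hc x hx) hxS
  | succ k ih =>
    intro x hx hxS
    by_cases hp : x ∈ pseudoFrobenius S
    · exact ⟨x, hp, 0, zero_mem _, add_zero x⟩
    · have : ∃ s ∈ S, s ≠ 0 ∧ x + s ∉ S := by
        by_contra hcon
        push Not at hcon
        exact hp ⟨hxS, hcon⟩
      obtain ⟨s, hs, hs0, hxs⟩ := this
      obtain ⟨g, hg, u, hu, rfl⟩ := ih (x + s) (by omega) hxs
      exact ⟨_, hg, s + u, add_mem hs hu, by omega⟩

theorem finite_pseudoFrobenius {S : AddSubmonoid ℕ} {c : ℕ} (hc : ∀ x, c ≤ x → x ∈ S) :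
    (pseudoFrobenius S).Finite :=
  (Set.finite_Iio c).subset fun g hg => by
    by_contra h
    exact hg.1 (hc g (not_lt.1 h))

theorem conductor_le_mul {S : AddSubmonoid ℕ} {c : ℕ} (hc : ∀ x, c ≤ x → x ∈ S) :
    c ≤ {s : ℕ | s ∈ S ∧ s < c}.ncard * ((pseudoFrobenius S).ncard + 1) := by
  set L := {s : ℕ | s ∈ S ∧ s < c}
  have hL : L.Finite := (Set.finite_Iio c).subset fun s hs => hs.2
  have hP := finite_pseudoFrobenius hc
  have hsub : Set.Iio c ⊆ L ∪ (fun p : ℕ × ℕ => p.2 - p.1) '' (L ×ˢ pseudoFrobenius S) := by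
    intro x hx
    by_cases hxS : x ∈ S
    · exact Or.inl ⟨hxS, hx⟩
    · obtain ⟨g, hg, s, hs, rfl⟩ := exists_pseudoFrobenius hc c x (by omega) hxS
      refine Or.inr ⟨(s, x + s), ⟨⟨hs, ?_⟩, hg⟩, by simp⟩
      by_contra h
      exact hg.1 (hc _ (by omega))
  have h1 := Set.ncard_le_ncard hsub (hL.union ((hL.prod hP).image _))
  have h2 := Set.ncard_union_le L
    ((fun p : ℕ × ℕ => p.2 - p.1) '' (L ×ˢ pseudoFrobenius S))
  have h3 := Set.ncard_image_le (f := fun p : ℕ × ℕ => p.2 - p.1) (hL.prod hP)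
  rw [Set.ncard_prod] at h3
  have h4 : (Set.Iio c).ncard = c := by
    rw [← Finset.coe_Iio, Set.ncard_coe_finset, Nat.card_Iio]
  rw [mul_add]
  omega

theorem ncard_pseudoFrobenius_singleton {S : AddSubmonoid ℕ} {a : ℕ} (ha : a ≠ 0)
    (hS : ∀ x, x ∈ S ↔ ∃ k, k * a = x) : (pseudoFrobenius S).ncard = 0 := by
  have : pseudoFrobenius S = ∅ := by
    refine Set.eq_empty_of_forall_notMem fun g hg => ?_
    obtain ⟨k, hk⟩ := (hS _).1 (hg.2 a ((hS a).2 ⟨1, one_mul a⟩) ha)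
    obtain _ | k := k
    · omega
    · exact hg.1 ((hS g).2 ⟨k, by rw [add_mul] at hk; omega⟩)
  rw [this, Set.ncard_empty]

/-- Since `g ∉ S` but `g + a ∈ S`, the sum `g + a` is a multiple of `b`. Two such `g` differ by a
multiple of `b`, so the larger would lie in `S`. -/
theorem ncard_pseudoFrobenius_pair {S : AddSubmonoid ℕ} {a b : ℕ} (ha : a ≠ 0)
    (hS : ∀ x, x ∈ S ↔ ∃ k i, k * a + i * b = x) : (pseudoFrobenius S).ncard ≤ 1 := by
  have haS : a ∈ S := (hS a).2 ⟨1, 0, by simp⟩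
  have hbS : b ∈ S := (hS b).2 ⟨0, 1, by simp⟩
  have key : ∀ g ∈ pseudoFrobenius S, ∃ i, g + a = i * b := by
    intro g hg
    obtain ⟨k, i, hk⟩ := (hS _).1 (hg.2 a haS ha)
    obtain _ | k := k
    · exact ⟨i, by omega⟩
    · exact absurd ((hS g).2 ⟨k, i, by rw [add_mul] at hk; omega⟩) hg.1
  have aux : ∀ g ∈ pseudoFrobenius S, ∀ g' ∈ pseudoFrobenius S, g ≤ g' → g = g' := by
    intro g hg g' hg' hle
    obtain ⟨i, hi⟩ := key g hg
    obtain ⟨j, hj⟩ := key g' hg'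
    by_contra hne
    have hij : i ≤ j := by
      by_contra h
      have := Nat.mul_le_mul_right b (not_le.1 h).le
      omega
    obtain ⟨e, rfl⟩ := Nat.exists_eq_add_of_le hij
    have hmul : (i + e) * b = i * b + e * b := add_mul _ _ _
    refine hg'.1 ?_
    rw [show g' = g + e * b by omega]
    exact hg.2 _ ((hS _).2 ⟨0, e, by simp⟩) (by omega)
  have hsub : (pseudoFrobenius S).Subsingleton := fun g hg g' hg' =>
    (le_total g g').elim (aux g hg g' hg') fun h => (aux g' hg' g hg h).symm
  exact (Set.ncard_le_one hsub.finite).2 fun g hg g' hg' => hsub hg hg'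

/-! ### Three generators: the staircase of standard pairs -/

/-- `(i, j)` is the representation `i * b + j * c` of an element of the Apéry set of `a` for which
`i` is as large as possible. -/
def IsStandard (S : AddSubmonoid ℕ) (a b c i j : ℕ) : Prop :=
  (∀ u ∈ S, u + a ≠ i * b + j * c) ∧ ∀ i' j', i' * b + j' * c = i * b + j * c → i' ≤ i

section ThreeGenerators

variable {S : AddSubmonoid ℕ} {a b c : ℕ}

theorem IsStandard.mono (hS : ∀ x, x ∈ S ↔ ∃ k i j, k * a + i * b + j * c = x) {i j i' j' : ℕ}
    (h : IsStandard S a b c i j) (hi : i' ≤ i) (hj : j' ≤ j) : IsStandard S a b c i' j' := by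
  obtain ⟨e, rfl⟩ := Nat.exists_eq_add_of_le hi
  obtain ⟨d, rfl⟩ := Nat.exists_eq_add_of_le hj
  constructor
  · intro u hu hua
    refine h.1 (u + (e * b + d * c)) (add_mem hu ((hS _).2 ⟨0, e, d, by ring⟩)) ?_
    linear_combination hua
  · intro x y hxy
    have := h.2 (x + e) (y + d) (by linear_combination hxy)
    omega

theorem IsStandard.unique (hc : c ≠ 0) {i j i' j' : ℕ} (h : IsStandard S a b c i j)
    (h' : IsStandard S a b c i' j') (heq : i * b + j * c = i' * b + j' * c) :
    i = i' ∧ j = j' := by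
  have h1 := h.2 _ _ heq.symm
  have h2 := h'.2 _ _ heq
  obtain rfl : i = i' := by omega
  exact ⟨rfl, Nat.eq_of_mul_eq_mul_right (Nat.pos_of_ne_zero hc) (by omega)⟩

theorem exists_isStandard (hS : ∀ x, x ∈ S ↔ ∃ k i j, k * a + i * b + j * c = x)
    (ha : a ≠ 0) (hb : b ≠ 0) (hc : c ≠ 0) {g : ℕ} (hg : g ∈ pseudoFrobenius S) :
    ∃ i j, IsStandard S a b c i j ∧ ¬ IsStandard S a b c (i + 1) j ∧
      ¬ IsStandard S a b c i (j + 1) ∧ g + a = i * b + j * c := by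
  have haS : a ∈ S := (hS a).2 ⟨1, 0, 0, by simp⟩
  have hbS : b ∈ S := (hS b).2 ⟨0, 1, 0, by simp⟩
  have hcS : c ∈ S := (hS c).2 ⟨0, 0, 1, by simp⟩
  have hex : ∃ i j, g + a = i * b + j * c := by
    obtain ⟨k, i, j, hk⟩ := (hS _).1 (hg.2 a haS ha)
    obtain _ | k := k
    · exact ⟨i, j, by omega⟩
    · exact absurd ((hS g).2 ⟨k, i, j, by rw [add_mul] at hk; omega⟩) hg.1
  classical
  obtain ⟨i₀, hi₀⟩ := hex
  have hbound : ∀ i j, i * b + j * c = g + a → i ≤ g + a := fun i j h => by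
    have := Nat.le_mul_of_pos_right i (Nat.pos_of_ne_zero hb)
    omega
  let P : ℕ → Prop := fun i => ∃ j, g + a = i * b + j * c
  have hle : i₀ ≤ g + a := by
    obtain ⟨j, hj⟩ := hi₀
    exact hbound _ _ hj.symm
  obtain ⟨j, hj⟩ : P (Nat.findGreatest P (g + a)) := Nat.findGreatest_spec hle hi₀
  refine ⟨Nat.findGreatest P (g + a), j, ⟨?_, ?_⟩, ?_, ?_, hj⟩
  · intro u hu h
    exact hg.1 (by rwa [show g = u by omega])
  · intro i' j' h
    rw [← hj] at h
    exact Nat.le_findGreatest (hbound _ _ h) ⟨j', h.symm⟩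
  -- `g + b ∈ S`, so `g + a + b` leaves the Apéry set of `a`; likewise for `c` below. Hence `(i, j)`
  -- is an outer corner.
  · intro h
    exact h.1 _ (hg.2 b hbS hb) (by linear_combination hj)
  · intro h
    exact h.1 _ (hg.2 c hcS hc) (by linear_combination hj)

/-- If a representation of `(x + 1) * b + (y + 1) * c` that violates standardness used `b` or `c`,
cancelling that generator would violate standardness of one of the two neighbours. So only `a` can
occur. -/
theorem exists_mul_eq_of_inner_corner
    (hS : ∀ x, x ∈ S ↔ ∃ k i j, k * a + i * b + j * c = x) {x y : ℕ}
    (h1 : IsStandard S a b c x (y + 1)) (h2 : IsStandard S a b c (x + 1) y)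
    (h3 : ¬ IsStandard S a b c (x + 1) (y + 1)) :
    ∃ k, (x + 1) * b + (y + 1) * c = k * a := by
  by_contra hcon
  push Not at hcon
  refine h3 ⟨?_, ?_⟩
  · rintro u hu hua
    obtain ⟨k, i, j, rfl⟩ := (hS u).1 hu
    obtain _ | i := i
    · obtain _ | j := j
      · exact hcon (k + 1) (by linear_combination -hua)
      · exact h2.1 (k * a + j * c) ((hS _).2 ⟨k, 0, j, by ring⟩) (by linarith)
    · exact h1.1 (k * a + i * b + j * c) ((hS _).2 ⟨k, i, j, rfl⟩) (by linarith)
  · intro i j hij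
    obtain _ | i := i
    · omega
    · have := h1.2 i j (by linarith)
      omega

theorem exists_last_true {p : ℕ → Prop} {m n : ℕ} (hmn : m ≤ n) (hm : p m) (hn : ¬ p n) :
    ∃ x, m ≤ x ∧ x < n ∧ p x ∧ ¬ p (x + 1) := by
  induction n, hmn using Nat.le_induction with
  | base => exact absurd hm hn
  | succ n hmn ih =>
    by_cases h : p n
    · exact ⟨n, hmn, n.lt_succ_self, h, hn⟩
    · obtain ⟨x, h1, h2, h3⟩ := ih h
      exact ⟨x, h1, by omega, h3⟩

/-- On either side of the middle corner the staircase has an inner corner, giving two relations with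
right sides `k * a` and `l * a`. Their difference relates `d * b`, `e * c` and a multiple of `a`,
while `(d, 0)` and `(0, e)` are both standard; each sign of `k - l` is then impossible. -/
theorem not_three_corners (hS : ∀ x, x ∈ S ↔ ∃ k i j, k * a + i * b + j * c = x)
    (hc : c ≠ 0) {p₁ q₁ p₂ q₂ p₃ q₃ : ℕ}
    (h1 : IsStandard S a b c p₁ q₁) (h2 : IsStandard S a b c p₂ q₂)
    (h3 : IsStandard S a b c p₃ q₃) (hr : ¬ IsStandard S a b c (p₂ + 1) q₂)
    (hu : ¬ IsStandard S a b c p₂ (q₂ + 1)) (hp₁ : p₁ < p₂) (hp₂ : p₂ < p₃)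
    (hq₁ : q₂ < q₁) (hq₂ : q₃ < q₂) : False := by
  obtain ⟨x, -, hx, hx1, hx2⟩ := exists_last_true (p := fun x => IsStandard S a b c x (q₂ + 1))
    hp₁.le (h1.mono hS le_rfl hq₁) hu
  obtain ⟨y, -, hy, hy1, hy2⟩ := exists_last_true (p := fun y => IsStandard S a b c (p₂ + 1) y)
    hq₂.le (h3.mono hS hp₂ le_rfl) hr
  obtain ⟨k, hk⟩ := exists_mul_eq_of_inner_corner hS hx1 (h2.mono hS hx le_rfl) hx2
  obtain ⟨l, hl⟩ := exists_mul_eq_of_inner_corner hS (h2.mono hS le_rfl hy) hy1 hy2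
  obtain ⟨d, rfl⟩ := Nat.exists_eq_add_of_le hx.le
  obtain ⟨e, rfl⟩ := Nat.exists_eq_add_of_le hy.le
  have hd : IsStandard S a b c d 0 := h2.mono hS (by omega) (by omega)
  have he : IsStandard S a b c 0 e := h2.mono hS (by omega) (by omega)
  rcases lt_trichotomy k l with hkl | rfl | hkl
  · obtain ⟨r, rfl⟩ := Nat.exists_eq_add_of_lt hkl
    exact hd.1 (r * a + e * c) ((hS _).2 ⟨r, 0, e, by ring⟩) (by linarith)
  · have := hd.unique hc he (by linarith)
    omega
  · obtain ⟨r, rfl⟩ := Nat.exists_eq_add_of_lt hkl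
    exact he.1 (r * a + d * b) ((hS _).2 ⟨r, d, 0, by ring⟩) (by linarith)

theorem ncard_pseudoFrobenius_triple (hS : ∀ x, x ∈ S ↔ ∃ k i j, k * a + i * b + j * c = x)
    (ha : a ≠ 0) (hb : b ≠ 0) (hc : c ≠ 0) (hfin : (pseudoFrobenius S).Finite) :
    (pseudoFrobenius S).ncard ≤ 2 := by
  by_contra! hcon
  obtain ⟨g₁, g₂, g₃, hg₁, hg₂, hg₃, h12, h13, h23⟩ := (Set.two_lt_ncard_iff hfin).1 hcon
  have anti : ∀ g ∈ pseudoFrobenius S, ∀ g' ∈ pseudoFrobenius S, g ≠ g' → ∀ i j i' j',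
      g + a = i * b + j * c → g' + a = i' * b + j' * c → i ≤ i' → j ≤ j' → False := by
    intro g hg g' hg' hne i j i' j' h h' hi hj
    obtain ⟨e, rfl⟩ := Nat.exists_eq_add_of_le hi
    obtain ⟨d, rfl⟩ := Nat.exists_eq_add_of_le hj
    have : g' = g + (e * b + d * c) := by linarith
    refine hg'.1 ?_
    rw [this]
    exact hg.2 _ ((hS _).2 ⟨0, e, d, by ring⟩) (by omega)
  obtain ⟨p₁, q₁, s1, r1, u1, e1⟩ := exists_isStandard hS ha hb hc hg₁
  obtain ⟨p₂, q₂, s2, r2, u2, e2⟩ := exists_isStandard hS ha hb hc hg₂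
  obtain ⟨p₃, q₃, s3, r3, u3, e3⟩ := exists_isStandard hS ha hb hc hg₃
  have cross : ∀ g ∈ pseudoFrobenius S, ∀ g' ∈ pseudoFrobenius S, g ≠ g' → ∀ i j i' j',
      g + a = i * b + j * c → g' + a = i' * b + j' * c →
        i < i' ∧ j' < j ∨ i' < i ∧ j < j' := by
    intro g hg g' hg' hne i j i' j' h h'
    have h1 := anti g hg g' hg' hne i j i' j' h h'
    have h2 := anti g' hg' g hg hne.symm i' j' i j h' h
    by_contra hcon
    rcases le_total i i' with hi | hi
    · exact (le_total j j').elim (h1 hi) fun hj => by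
        rcases hi.eq_or_lt with rfl | hi'
        · exact h2 le_rfl hj
        · rcases hj.eq_or_lt with rfl | hj'
          · exact h1 hi le_rfl
          · exact hcon (Or.inl ⟨hi', hj'⟩)
    · exact (le_total j' j).elim (h2 hi) fun hj => by
        rcases hi.eq_or_lt with rfl | hi'
        · exact h1 le_rfl hj
        · rcases hj.eq_or_lt with rfl | hj'
          · exact h2 hi le_rfl
          · exact hcon (Or.inr ⟨hi', hj'⟩)
  -- The corners are pairwise incomparable, so one lies strictly between the other two. Of the eight
  -- sign patterns below, six are orderings and two are cyclic.
  have c1 := not_three_corners hS hc s2 s1 s3 r1 u1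
  have c1' := not_three_corners hS hc s3 s1 s2 r1 u1
  have c2 := not_three_corners hS hc s1 s2 s3 r2 u2
  have c2' := not_three_corners hS hc s3 s2 s1 r2 u2
  have c3 := not_three_corners hS hc s1 s3 s2 r3 u3
  have c3' := not_three_corners hS hc s2 s3 s1 r3 u3
  rcases cross _ hg₁ _ hg₂ h12 _ _ _ _ e1 e2 with ⟨x, x'⟩ | ⟨x, x'⟩ <;>
    rcases cross _ hg₁ _ hg₃ h13 _ _ _ _ e1 e3 with ⟨y, y'⟩ | ⟨y, y'⟩ <;>
    rcases cross _ hg₂ _ hg₃ h23 _ _ _ _ e2 e3 with ⟨z, z'⟩ | ⟨z, z'⟩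
  · exact c2 x z x' z'
  · exact c3 y z y' z'
  · omega
  · exact c1' y x y' x'
  · exact c1 x y x' y'
  · omega
  · exact c3' z y z' y'
  · exact c2' z x z' x'

end ThreeGenerators

theorem ncard_pseudoFrobenius_lt {S : AddSubmonoid ℕ} {c : ℕ} (hc : ∀ x, c ≤ x → x ∈ S)
    (h3 : embeddingDim S ≤ 3) (hfin : (minimalGenerators S).Finite) :
    (pseudoFrobenius S).ncard + 1 ≤ embeddingDim S := by
  have hcl := closure_minimalGenerators S
  have hne : ∀ g ∈ minimalGenerators S, g ≠ 0 := fun g hg => hg.2.1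
  have hmem : ∀ x, x ∈ S ↔ x ∈ AddSubmonoid.closure (minimalGenerators S) := by simp [hcl]
  unfold embeddingDim at *
  generalize minimalGenerators S = G at *
  obtain h | h | h | h : G.ncard = 0 ∨ G.ncard = 1 ∨ G.ncard = 2 ∨ G.ncard = 3 := by omega
  · rw [Set.ncard_eq_zero hfin] at h
    subst h
    have := (hmem (c + 1)).1 (hc _ (by omega))
    simp at this
  · obtain ⟨a, rfl⟩ := Set.ncard_eq_one.1 h
    have := ncard_pseudoFrobenius_singleton (S := S) (a := a) (hne a (by simp)) (by
      simpa [AddSubmonoid.mem_closure_singleton] using hmem)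
    omega
  · obtain ⟨a, b, -, rfl⟩ := Set.ncard_eq_two.1 h
    have := ncard_pseudoFrobenius_pair (S := S) (a := a) (b := b) (hne a (by simp)) (by
      simpa [AddSubmonoid.mem_closure_pair] using hmem)
    omega
  · obtain ⟨a, b, d, -, -, -, rfl⟩ := Set.ncard_eq_three.1 h
    have := ncard_pseudoFrobenius_triple (S := S) (a := a) (b := b) (c := d) (fun x => by
      rw [hmem, Set.insert_eq, AddSubmonoid.closure_union, AddSubmonoid.mem_sup]
      simp [AddSubmonoid.mem_closure_pair, AddSubmonoid.mem_closure_singleton, add_assoc])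
      (hne a (by simp)) (hne b (by simp)) (hne d (by simp)) (finite_pseudoFrobenius hc)
    omega

/-! ### The Apéry set of the multiplicity -/

section Apery

variable {S : AddSubmonoid ℕ} {c m : ℕ}

/-- The Apéry set of a semigroup with conductor at most `c` with respect to `m`. -/
noncomputable def apery (S : AddSubmonoid ℕ) (c m : ℕ) : Finset ℕ := by
  classical exact {w ∈ Finset.range (c + m) | w ∈ S ∧ ∀ u ∈ S, u + m ≠ w}

theorem mem_apery (hc : ∀ x, c ≤ x → x ∈ S) {w : ℕ} :
    w ∈ apery S c m ↔ w ∈ S ∧ ∀ u ∈ S, u + m ≠ w := by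
  classical
  simp only [apery, Finset.mem_filter, Finset.mem_range, and_iff_right_iff_imp]
  rintro ⟨-, h⟩
  by_contra hlt
  exact h (w - m) (hc _ (by omega)) (by omega)

theorem lt_of_mem_apery {w : ℕ} (hw : w ∈ apery S c m) : w < c + m := by
  classical
  simp only [apery, Finset.mem_filter, Finset.mem_range] at hw
  exact hw.1

theorem add_mul_mem (hmS : m ∈ S) {x : ℕ} (hx : x ∈ S) (k : ℕ) : x + k * m ∈ S :=
  add_mem hx (by simpa using nsmul_mem hmS k)

theorem apery_injOn_mod (hc : ∀ x, c ≤ x → x ∈ S) (hmS : m ∈ S) :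
    Set.InjOn (· % m) (apery S c m : Set ℕ) := by
  have aux : ∀ v ∈ apery S c m, ∀ w ∈ apery S c m, v % m = w % m → v ≤ w → v = w := by
    intro v hv w hw h hle
    rw [mem_apery hc] at hv hw
    obtain ⟨k, hk⟩ := (Nat.modEq_iff_dvd' hle).1 h
    obtain _ | k := k
    · omega
    · refine absurd ?_ (hw.2 _ (add_mul_mem hmS hv.1 k))
      have : w = v + m * (k + 1) := by omega
      rw [this]
      ring
  intro v hv w hw h
  exact (le_total v w).elim (aux v hv w hw h) fun hle => (aux w hw v hv h.symm hle).symm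

theorem card_apery (hc : ∀ x, c ≤ x → x ∈ S) (hmS : m ∈ S) (hm : 0 < m) :
    (apery S c m).card = m := by
  classical
  have him : (apery S c m).image (· % m) = Finset.range m := by
    ext r
    simp only [Finset.mem_image, Finset.mem_range]
    constructor
    · rintro ⟨w, -, rfl⟩
      exact Nat.mod_lt _ hm
    · intro hr
      have hex : ∃ k, r + k * m ∈ S :=
        ⟨c, hc _ (le_add_left (Nat.le_mul_of_pos_right c hm))⟩
      refine ⟨r + Nat.find hex * m, (mem_apery hc).2 ⟨Nat.find_spec hex, ?_⟩, by
        simp [Nat.mod_eq_of_lt hr]⟩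
      intro u hu hum
      have hmin := fun k => Nat.find_min hex (m := k)
      generalize Nat.find hex = k at *
      obtain _ | k := k
      · omega
      · refine hmin k k.lt_succ_self ?_
        rw [show r + k * m = u by linarith]
        exact hu
  rw [← Finset.card_image_of_injOn (apery_injOn_mod hc hmS), him, Finset.card_range]

/-- The summand counts the `k` with `w + k * m < c`, and these elements are distinct for distinct
`(w, k)`. -/
theorem sum_apery_le_ncard (hc : ∀ x, c ≤ x → x ∈ S) (hmS : m ∈ S) (hm : 0 < m) :
    ∑ w ∈ apery S c m, (c + m - 1 - w) / m ≤ {s : ℕ | s ∈ S ∧ s < c}.ncard := by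
  have hfin : {s : ℕ | s ∈ S ∧ s < c}.Finite := (Set.finite_Iio c).subset fun s hs => hs.2
  rw [Set.ncard_eq_toFinset_card _ hfin]
  have : ∑ w ∈ apery S c m, (c + m - 1 - w) / m =
      ((apery S c m).sigma fun w => Finset.range ((c + m - 1 - w) / m)).card := by
    simp
  rw [this]
  refine Finset.card_le_card_of_injOn (fun p => p.1 + p.2 * m) ?_ ?_
  · rintro ⟨w, k⟩ hp
    simp only [Finset.coe_sigma, Set.mem_sigma_iff, Finset.mem_coe, Finset.mem_range] at hp
    simp only [Set.Finite.coe_toFinset, Set.mem_ofPred_eq]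
    refine ⟨add_mul_mem hmS ((mem_apery hc).1 hp.1).1 k, ?_⟩
    have := (Nat.le_div_iff_mul_le hm).1 (Nat.succ_le_of_lt hp.2)
    have h2 : k.succ * m = k * m + m := Nat.succ_mul k m
    omega
  · rintro ⟨v, k⟩ hp ⟨w, l⟩ hq h
    simp only [Finset.coe_sigma, Set.mem_sigma_iff, Finset.mem_coe, Finset.mem_range] at hp hq
    dsimp only at h
    have hvw : v = w := apery_injOn_mod hc hmS hp.1 hq.1 (by
      have := congrArg (· % m) h
      simpa using this)
    subst hvw
    have : k = l := Nat.eq_of_mul_eq_mul_right hm (by omega)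
    subst this
    rfl

/-- The nonzero elements of the Apéry set that are not minimal generators. -/
noncomputable def decomposables (S : AddSubmonoid ℕ) (c m : ℕ) : Finset ℕ := by
  classical exact {w ∈ apery S c m | w ≠ 0 ∧ w ∉ minimalGenerators S}

/-- The minimal generators are `m` and the indecomposable nonzero Apéry elements; there are `m - 1`
nonzero Apéry elements in all. -/
theorem embeddingDim_add_card_decomposables (hc : ∀ x, c ≤ x → x ∈ S) (hmS : m ∈ S)
    (hm : 0 < m) (hmin : ∀ s ∈ S, 0 < s → m ≤ s) :
    embeddingDim S + (decomposables S c m).card = m := by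
  classical
  have hmg : m ∈ minimalGenerators S := by
    refine ⟨hmS, hm.ne', ?_⟩
    rintro s hs hs0 ⟨u, -, rfl⟩
    have := hmin s hs (by omega)
    omega
  have h0 : 0 ∈ apery S c m := (mem_apery hc).2 ⟨zero_mem _, fun u _ h => by omega⟩
  have hgen : minimalGenerators S =
      (insert m {w ∈ apery S c m | w ≠ 0 ∧ w ∈ minimalGenerators S} : Finset ℕ) := by
    ext g
    simp only [Finset.coe_insert, Finset.coe_filter, Set.mem_insert_iff, Set.mem_ofPred_eq]
    constructor
    · intro hg
      by_cases hgm : g = m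
      · exact Or.inl hgm
      · refine Or.inr ⟨(mem_apery hc).2 ⟨hg.1, fun u hu h => hgm ?_⟩, hg.2.1, hg⟩
        exact (hg.2.2 m hmS hm.ne' ⟨u, hu, by omega⟩).symm
    · rintro (rfl | h)
      · exact hmg
      · exact h.2.2
  have hdim : embeddingDim S =
      (insert m {w ∈ apery S c m | w ≠ 0 ∧ w ∈ minimalGenerators S} : Finset ℕ).card := by
    unfold embeddingDim
    rw [← Set.ncard_coe_finset, ← hgen]
  have hmA : m ∉ apery S c m := fun h => ((mem_apery hc).1 h).2 0 (zero_mem _) (by omega)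
  rw [Finset.card_insert_of_notMem (by simp [hmA])] at hdim
  have hsplit := Finset.card_filter_add_card_filter_not (s := (apery S c m).erase 0)
    (fun w => w ∈ minimalGenerators S)
  rw [Finset.card_erase_of_mem h0, card_apery hc hmS hm] at hsplit
  have e1 : {w ∈ (apery S c m).erase 0 | w ∈ minimalGenerators S} =
      {w ∈ apery S c m | w ≠ 0 ∧ w ∈ minimalGenerators S} := by
    ext w; simp only [Finset.mem_filter, Finset.mem_erase]; tauto
  have e2 : {w ∈ (apery S c m).erase 0 | w ∉ minimalGenerators S} = decomposables S c m := by
    ext w; simp only [decomposables, Finset.mem_filter, Finset.mem_erase]; tauto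
  rw [e1, e2] at hsplit
  omega

theorem exists_add_eq_of_mem_decomposables (hc : ∀ x, c ≤ x → x ∈ S) {v : ℕ}
    (hv : v ∈ decomposables S c m) :
    ∃ u ∈ (apery S c m).erase 0, ∃ w ∈ (apery S c m).erase 0, u + w = v := by
  classical
  simp only [decomposables, Finset.mem_filter, mem_apery hc] at hv
  obtain ⟨⟨hvS, hvm⟩, hv0, hvg⟩ := hv
  have : ∃ s ∈ S, s ≠ 0 ∧ Preceq S s v ∧ s ≠ v := by
    by_contra hcon
    push Not at hcon
    exact hvg ⟨hvS, hv0, hcon⟩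
  obtain ⟨u, hu, hu0, ⟨w, hw, rfl⟩, hne⟩ := this
  refine ⟨u, ?_, w, ?_, rfl⟩
  · rw [Finset.mem_erase, mem_apery hc]
    exact ⟨hu0, hu, fun x hx h => hvm (x + w) (add_mem hx hw) (by omega)⟩
  · rw [Finset.mem_erase, mem_apery hc]
    exact ⟨by omega, hw, fun x hx h => hvm (x + u) (add_mem hx hu) (by omega)⟩

end Apery

/-! ### Weights on the graph of decompositions -/

/-- A weight `N` on a vertex set `V` of a graph with loops that has weight at least `Q` on every
edge, every vertex lying on an edge and having positive weight. -/
theorem add_card_le_sum_add_two {V : Finset ℕ} {N : ℕ → ℕ} {Q : ℕ} (hV : 2 ≤ V.card)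
    (hN : ∀ v ∈ V, 1 ≤ N v) (hE : ∀ u ∈ V, ∃ w ∈ V, Q ≤ N u + N w) :
    Q + V.card ≤ ∑ v ∈ V, N v + 2 := by
  -- If every heavy edge were a loop, each vertex would weigh at least `Q / 2`, and any two distinct
  -- vertices would form a heavy edge. The other vertices then add at least 1 each.
  obtain ⟨u, hu, w, hw, hne, huw⟩ : ∃ u ∈ V, ∃ w ∈ V, u ≠ w ∧ Q ≤ N u + N w := by
    by_contra! hcon
    obtain ⟨u, hu, w, hw, hne⟩ := Finset.one_lt_card.1 hV
    have hloop : ∀ x ∈ V, Q ≤ N x + N x := fun x hx => by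
      obtain ⟨y, hy, hxy⟩ := hE x hx
      by_cases h : x = y
      · rwa [← h] at hxy
      · exact absurd hxy (not_le.2 (hcon x hx y hy h))
    have := hcon u hu w hw hne
    have := hloop u hu
    have := hloop w hw
    omega
  have h1 := Finset.add_sum_erase V N hu
  have hw' : w ∈ V.erase u := Finset.mem_erase.2 ⟨hne.symm, hw⟩
  have h2 := Finset.add_sum_erase (V.erase u) N hw'
  have h3 : ((V.erase u).erase w).card ≤ ∑ v ∈ (V.erase u).erase w, N v := by
    rw [Finset.card_eq_sum_ones]
    exact Finset.sum_le_sum fun v hv =>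
      hN v (Finset.mem_of_mem_erase (Finset.mem_of_mem_erase hv))
  rw [Finset.card_erase_of_mem hw', Finset.card_erase_of_mem hu] at h3
  omega

theorem card_le_choose_of_forall_exists_add {D V : Finset ℕ}
    (h : ∀ v ∈ D, ∃ u ∈ V, ∃ w ∈ V, u + w = v) : D.card ≤ (V.card + 1).choose 2 := by
  rw [← Finset.card_sym2]
  have hsub : D ⊆ V.sym2.image (Sym2.lift ⟨fun u w => u + w, fun u w => add_comm u w⟩) := by
    intro v hv
    obtain ⟨u, hu, w, hw, rfl⟩ := h v hv
    exact Finset.mem_image.2 ⟨s(u, w), Finset.mk_mem_sym2_iff.2 ⟨hu, hw⟩, rfl⟩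
  exact (Finset.card_le_card hsub).trans Finset.card_image_le

theorem conductor_le_of_four_le {S : AddSubmonoid ℕ} {c m : ℕ} (hc : ∀ x, c ≤ x → x ∈ S)
    (hmS : m ∈ S) (hm : 0 < m) (hmin : ∀ s ∈ S, 0 < s → m ≤ s) (h8 : m ≤ 8)
    (h4 : 4 ≤ embeddingDim S) :
    c ≤ {s : ℕ | s ∈ S ∧ s < c}.ncard * embeddingDim S := by
  classical
  set N : ℕ → ℕ := fun w => (c + m - 1 - w) / m with hNdef
  set A := apery S c m with hA
  set D := decomposables S c m with hD
  set ν := embeddingDim S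
  have hdim : ν + D.card = m := embeddingDim_add_card_decomposables hc hmS hm hmin
  set V := {u ∈ A.erase 0 | ∃ w ∈ A.erase 0, u + w ∈ D} with hVdef
  have hDV : ∀ v ∈ D, ∃ u ∈ V, ∃ w ∈ V, u + w = v := by
    intro v hv
    obtain ⟨u, hu, w, hw, rfl⟩ := exists_add_eq_of_mem_decomposables hc hv
    exact ⟨u, Finset.mem_filter.2 ⟨hu, w, hw, hv⟩, w,
      Finset.mem_filter.2 ⟨hw, u, hu, by rwa [add_comm]⟩, rfl⟩
  have hcard := card_le_choose_of_forall_exists_add hDV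
  have hsum : N 0 + ∑ w ∈ V, N w ≤ {s : ℕ | s ∈ S ∧ s < c}.ncard := by
    have h0 : 0 ∈ A := (mem_apery hc).2 ⟨zero_mem _, fun u _ h => by omega⟩
    refine le_trans ?_ (sum_apery_le_ncard hc hmS hm)
    rw [← Finset.add_sum_erase _ _ h0]
    exact Nat.add_le_add_left
      (Finset.sum_le_sum_of_subset (Finset.filter_subset _ _)) _
  have hspec : ∀ w, w ≤ c + m - 1 → c ≤ w + N w * m ∧ w + N w * m < c + m := by
    intro w hw
    have h1 := Nat.div_add_mod (c + m - 1 - w) m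
    have h2 := Nat.mod_lt (c + m - 1 - w) hm
    rw [mul_comm] at h1
    simp only [hNdef]
    omega
  have hq := hspec 0 (by omega)
  have hmem : ∀ u ∈ V, ∃ w ∈ V, u + w < c + m ∧ m ≤ u ∧ m ≤ w := by
    intro u hu
    obtain ⟨hu1, w, hw, huw⟩ := Finset.mem_filter.1 hu
    refine ⟨w, Finset.mem_filter.2 ⟨hw, u, hu1, by rwa [add_comm]⟩, ?_, ?_, ?_⟩
    · exact lt_of_mem_apery (Finset.mem_filter.1 huw).1
    · exact hmin u ((mem_apery hc).1 (Finset.mem_of_mem_erase hu1)).1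
        (Nat.pos_of_ne_zero (Finset.ne_of_mem_erase hu1))
    · exact hmin w ((mem_apery hc).1 (Finset.mem_of_mem_erase hw)).1
        (Nat.pos_of_ne_zero (Finset.ne_of_mem_erase hw))
  have hpos : ∀ u ∈ V, 1 ≤ N u := by
    intro u hu
    obtain ⟨w, -, h1, h2, h3⟩ := hmem u hu
    have := hspec u (by omega)
    by_contra h
    have h0 : N u = 0 := by omega
    rw [h0] at this
    omega
  have hcardsum : V.card ≤ ∑ w ∈ V, N w := by
    rw [Finset.card_eq_sum_ones]
    exact Finset.sum_le_sum hpos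
  have hedge : ∀ u ∈ V, ∃ w ∈ V, N 0 ≤ N u + N w + 1 ∧ (c = N 0 * m → N 0 ≤ N u + N w) := by
    intro u hu
    obtain ⟨w, hw, h1, h2, h3⟩ := hmem u hu
    have hu' := hspec u (by omega)
    have hw' := hspec w (by omega)
    refine ⟨w, hw, ?_, fun hcq => ?_⟩
    · have : N 0 * m < (N u + N w + 2) * m := by linarith
      have := Nat.lt_of_mul_lt_mul_right this
      omega
    · have : N 0 * m < (N u + N w + 1) * m := by linarith
      have := Nat.lt_of_mul_lt_mul_right this
      omega
  set q := N 0
  set T := ∑ w ∈ V, N w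
  -- The slack of 1 is affordable when `c ≠ q * m`, as then `c ≤ q * m - 1`.
  have hred : q * D.card ≤ 4 * T + 1 ∧ (c = q * m → q * D.card ≤ 4 * T) := by
    have hD4 : D.card ≤ 4 := by omega
    rcases Nat.lt_or_ge V.card 2 with hV | hV
    · have hV1 : V.card = 0 ∨ V.card = 1 := by omega
      rcases hV1 with hV1 | hV1
      · have hD0 : D.card = 0 := by simpa [hV1] using hcard
        simp [hD0]
      · have hD1 : D.card ≤ 1 := by simpa [hV1] using hcard
        obtain ⟨u, hu⟩ := Finset.card_pos.1 (by omega : 0 < V.card)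
        obtain ⟨w, hw, h, -⟩ := hedge u hu
        have h1 : N u ≤ T := Finset.single_le_sum (fun _ _ => Nat.zero_le _) hu
        have h2 : N w ≤ T := Finset.single_le_sum (fun _ _ => Nat.zero_le _) hw
        have h3 := Nat.mul_le_mul_left q hD1
        omega
    · have h1 := add_card_le_sum_add_two (Q := q - 1) hV hpos fun u hu => by
        obtain ⟨w, hw, h, -⟩ := hedge u hu
        exact ⟨w, hw, by omega⟩
      have h2 : c = q * m → q + V.card ≤ T + 2 := fun hcq =>
        add_card_le_sum_add_two hV hpos fun u hu => by
          obtain ⟨w, hw, -, h⟩ := hedge u hu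
          exact ⟨w, hw, h hcq⟩
      -- Two summands give at most three sums. Here only `q ≤ T + 1` is known in general, and `3 *
      -- (T + 1) ≤ 4 * T + 1` because `T ≥ 2`. With `|V| ≥ 3` one has `q ≤ T`, so `|D| ≤ 4` is
      -- enough.
      have h3 : V.card = 2 → D.card ≤ 3 := fun h => by
        rw [h] at hcard
        exact hcard
      change q - 1 + V.card ≤ T + 2 at h1
      by_cases hV2 : V.card = 2
      · have := Nat.mul_le_mul_left q (h3 hV2)
        omega
      · have := Nat.mul_le_mul_left q hD4
        omega
  have hgoal : c ≤ (q + T) * ν := by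
    have h1 : T * 4 ≤ T * ν := Nat.mul_le_mul_left T h4
    have h2 : q * m = q * ν + q * D.card := by rw [← hdim, mul_add]
    rw [add_mul]
    omega
  exact hgoal.trans (Nat.mul_le_mul_right _ hsum)

end NumSgp

theorem mainTheorem2 (S : AddSubmonoid ℕ) (hS : NumSgp.IsNumericalSemigroup S)
    (hm : NumSgp.multiplicity S ≤ 8) : NumSgp.SatisfiesWilf S := by
  obtain ⟨c, hfc, hc, hn⟩ := NumSgp.exists_conductor hS
  obtain ⟨⟨hmS, hm0⟩, hmin⟩ := NumSgp.isLeast_multiplicity hS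
  have key : c ≤ NumSgp.smallCount S * NumSgp.embeddingDim S := by
    rw [hn]
    by_cases h : NumSgp.embeddingDim S ≤ 3
    · exact (NumSgp.conductor_le_mul hc).trans (Nat.mul_le_mul_left _
        (NumSgp.ncard_pseudoFrobenius_lt hc h (NumSgp.finite_minimalGenerators hS)))
    · exact NumSgp.conductor_le_of_four_le hc hmS hm0 (fun s hs h0 => hmin ⟨hs, h0⟩) hm
        (by omega)
  unfold NumSgp.SatisfiesWilf
  rw [hfc]
  exact_mod_cast key
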